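/- Let $n,m,q,k\ge 0$ be integers and let $G(\mathbf x)$ be a symmetric $q\times q$ matrix of real polynomials in $\mathbf x=(x_1,\dots,x_n)$ that is not constant, i.e. $\deg(G):=\max_{i,j}\deg(G_{ij})\ge 1$. Put $d_G:=\lceil \deg(G)/2\rceil$ and $\mathcal X:=\{\mathbf x\in\mathbb R^n \mid G(\mathbf x)\succeq 0\}$. For $d\in\mathbb N$ let $\mathbb N^n_d:=\{\boldsymbol\alpha\in\mathbb N^n\mid \alpha_1+\dots+\alpha_n\le d\}$. For a sequence $\mathbf T=(T_{\boldsymbol\alpha})_{\boldsymbol\alpha\in\mathbb N^n_{2d}}$ of real symmetric $m\times m$ matrices, the moment matrix $M_d(\mathbf T)$ is the block matrix $(T_{\boldsymbol\alpha+\boldsymbol\beta})_{\boldsymbol\alpha,\boldsymbol\beta\in\mathbb N^n_d}$. If $d=k+d_G$, the localizing matrix $M_k(G\mathbf T)$ is the block matrix indexed by $\boldsymbol\alpha,\boldsymbol\beta\in\mathbb N^n_k$ with blocks $\sum_{\boldsymbol\gamma\in\operatorname{supp}(G)}T_{\boldsymbol\alpha+\boldsymbol\beta+\boldsymbol\gamma}\otimes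 G_{\boldsymbol\gamma}$, where $G_{\boldsymbol\gamma}$ is the coefficient matrix of $\mathbf x^{\boldsymbol\gamma}$ in $G$ and $\operatorname{supp}(G)$ is the set of exponents that occur in some entry of $G$. A positive semidefinite (PSD) matrix-valued measure on $\mathcal X$ is a symmetric matrix $\Phi=[\phi_{ij}]_{i,j=1}^m$ of finite signed Borel measures on $\mathcal X$ such that $\Phi(A)=[\phi_{ij}(A)]\succeq 0$ for every Borel set $A\subseteq\mathcal X$; it is a representing measure of $\mathbf T$ if every $\mathbf x^{\boldsymbol\alpha}$ with $\boldsymbol\alpha\in\mathbb N^n_{2d}$ is integrable with respect to all $\phi_{ij}$ and $T_{\boldsymbol\alpha}=\big[\int_{\mathcal X}\mathbf x^{\boldsymbol\alpha}\,\mathrm d\phi_{ij}\big]_{i,j}$. **Theorem.** Let $\mathbf S=(S_{\boldsymbol\alpha})_{\boldsymbol\alpha\in\mathbb N^n_{2k}}$ be a truncated sequence of real symmetric $m\times m$ matrices. The following statements are equivalent: (i) $\mathbf S$ has a finitely atomic representing measure $\Phi=\sum_{i=1}^r W_i\,\delta_{\mathbf x^{(i)}}$ (with $r\ge 0$; the zero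 measure if $r=0$), where the $W_i$ are real symmetric PSD $m\times m$ matrices and $\mathbf x^{(1)},\dots,\mathbf x^{(r)}$ are distinct points of $\mathcal X$, such that $\sum_{i=1}^r\operatorname{rank}(W_i)=\operatorname{rank}(M_k(\mathbf S))$; (ii) $M_k(\mathbf S)\succeq 0$, and $\mathbf S$ can be extended to a sequence $\tilde{\mathbf S}=(\tilde S_{\boldsymbol\alpha})_{\boldsymbol\alpha\in\mathbb N^n_{2(k+d_G)}}$ of real symmetric $m\times m$ matrices such that $M_{k+d_G}(\tilde{\mathbf S})\succeq 0$, $M_k(G\tilde{\mathbf S})\succeq 0$ and $\operatorname{rank}(M_k(\mathbf S))=\operatorname{rank}(M_{k+d_G}(\tilde{\mathbf S}))$. Here rank is the usual matrix rank. -/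

import Mathlib

open MeasureTheory
open scoped Kronecker

noncomputable section

namespace MatrixMoment

/-- The index set of exponents `α ∈ ℕⁿ` with `|α| = α₁ + ⋯ + αₙ ≤ d`. -/
abbrev MultiIndex (n d : ℕ) : Type := {α : Fin n →₀ ℕ // α.degree ≤ d}

instance (n d : ℕ) : Fintype (MultiIndex n d) :=
  (Finsupp.finite_of_degree_le (σ := Fin n) d).fintype

/-- The monomial function `x ↦ x^α`. -/
def monomialFun {n : ℕ} (α : Fin n →₀ ℕ) (x : Fin n → ℝ) : ℝ := ∏ i, x i ^ α i

/-! ### Truncated sequences and moment matrices -/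

/-- A truncated sequence `(S_α)_{|α| ≤ d}` of real `m × m` matrices. -/
abbrev TruncSeq (n m d : ℕ) : Type := MultiIndex n d → Matrix (Fin m) (Fin m) ℝ

/-- All the entries of the sequence are symmetric matrices. -/
def TruncSeq.IsSymm {n m d : ℕ} (S : TruncSeq n m d) : Prop := ∀ α, (S α).IsSymm

/-- `S'` is an extension of `S`: it is at least as long and agrees with `S` on its indices. -/
def TruncSeq.IsExtension {n m d d' : ℕ} (S : TruncSeq n m d) (S' : TruncSeq n m d') : Prop :=
  d ≤ d' ∧ ∀ (α : MultiIndex n d) (β : MultiIndex n d'), β.1 = α.1 → S' β = S α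

theorem degree_add_le {n k : ℕ} (α β : MultiIndex n k) : (α.1 + β.1).degree ≤ 2 * k := by
  have h1 := α.2
  have h2 := β.2
  rw [map_add]
  omega

/-- The moment matrix `M_k(S)`, with `(α, β)`-th block `S_{α+β}`, for `|α|, |β| ≤ k`. -/
def momentMatrix {n m k : ℕ} (S : TruncSeq n m (2 * k)) :
    Matrix (MultiIndex n k × Fin m) (MultiIndex n k × Fin m) ℝ :=
  Matrix.of fun a b => S ⟨a.1.1 + b.1.1, degree_add_le a.1 b.1⟩ a.2 b.2

/-! ### Polynomial matrices and localizing matrices -/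

/-- A `q × q` matrix of real polynomials in `n` variables. -/
abbrev PolyMatrix (n q : ℕ) : Type := Matrix (Fin q) (Fin q) (MvPolynomial (Fin n) ℝ)

/-- The degree of a polynomial matrix: the largest total degree of its entries. -/
def PolyMatrix.deg {n q : ℕ} (G : PolyMatrix n q) : ℕ :=
  Finset.univ.sup fun p : Fin q × Fin q => (G p.1 p.2).totalDegree

/-- `d_G = ⌈deg(G) / 2⌉`. -/
def PolyMatrix.halfDeg {n q : ℕ} (G : PolyMatrix n q) : ℕ := (G.deg + 1) / 2

/-- The exponents `γ` for which `x^γ` appears in some entry of `G`. -/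
def PolyMatrix.supp {n q : ℕ} (G : PolyMatrix n q) : Finset (Fin n →₀ ℕ) :=
  Finset.univ.biUnion fun p : Fin q × Fin q => (G p.1 p.2).support

/-- The coefficient matrix `G_γ` of `x^γ` in `G`. -/
def PolyMatrix.coeffMatrix {n q : ℕ} (G : PolyMatrix n q) (γ : Fin n →₀ ℕ) :
    Matrix (Fin q) (Fin q) ℝ :=
  G.map fun p => p.coeff γ

/-- The matrix `G(x)`. -/
def PolyMatrix.evalAt {n q : ℕ} (G : PolyMatrix n q) (x : Fin n → ℝ) :
    Matrix (Fin q) (Fin q) ℝ :=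
  G.map fun p => MvPolynomial.eval x p

/-- The set `{x ∈ ℝⁿ | G(x) ⪰ 0}`. -/
def PolyMatrix.psdSet {n q : ℕ} (G : PolyMatrix n q) : Set (Fin n → ℝ) :=
  {x | (G.evalAt x).PosSemidef}

theorem PolyMatrix.degree_le_of_mem_supp {n q : ℕ} (G : PolyMatrix n q) {γ : Fin n →₀ ℕ}
    (h : γ ∈ G.supp) : γ.degree ≤ 2 * G.halfDeg := by
  simp only [PolyMatrix.supp, Finset.mem_biUnion, Finset.mem_univ, true_and] at h
  obtain ⟨p, hp⟩ := h
  have h1 : γ.degree ≤ (G p.1 p.2).totalDegree := by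
    have := MvPolynomial.le_totalDegree hp
    simpa [Finsupp.degree_apply, Finsupp.sum] using this
  have h2 : (G p.1 p.2).totalDegree ≤ G.deg :=
    Finset.le_sup (f := fun p : Fin q × Fin q => (G p.1 p.2).totalDegree) (Finset.mem_univ p)
  unfold PolyMatrix.halfDeg
  omega

theorem degree_add_add_le {n q k : ℕ} (G : PolyMatrix n q) (α β : MultiIndex n k)
    (γ : {γ // γ ∈ G.supp}) : (α.1 + β.1 + γ.1).degree ≤ 2 * (k + G.halfDeg) := by
  have h1 := α.2
  have h2 := β.2
  have h3 := G.degree_le_of_mem_supp γ.2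
  rw [map_add, map_add]
  omega

/-- The localizing matrix `M_k(G S)`, with `(α, β)`-th block
`∑_{γ ∈ supp G} S_{α+β+γ} ⊗ G_γ`, for `|α|, |β| ≤ k`. -/
def localizingMatrix {n m q k : ℕ} (G : PolyMatrix n q) (S : TruncSeq n m (2 * (k + G.halfDeg))) :
    Matrix (MultiIndex n k × (Fin m × Fin q)) (MultiIndex n k × (Fin m × Fin q)) ℝ :=
  Matrix.of fun a b =>
    (∑ γ ∈ G.supp.attach,
      S ⟨a.1.1 + b.1.1 + γ.1, degree_add_add_le G a.1 b.1 γ⟩ ⊗ₖ G.coeffMatrix γ.1) a.2 b.2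

/-! ### Matrix-valued measures -/

/-- An `m × m` matrix-valued Borel measure on `X ⊆ ℝⁿ`. -/
abbrev MatrixMeasure {n : ℕ} (m : ℕ) (X : Set (Fin n → ℝ)) : Type :=
  VectorMeasure X (Matrix (Fin m) (Fin m) ℝ)

variable {n m : ℕ} {X : Set (Fin n → ℝ)}

/-- The `(i, j)`-th entry `φ_ij` of a matrix-valued measure, a finite signed measure. -/
def MatrixMeasure.entry (Φ : MatrixMeasure m X) (i j : Fin m) : SignedMeasure X :=
  VectorMeasure.mapRange Φ (Matrix.entryAddMonoidHom ℝ i j) (continuous_id.matrix_elem i j)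

/-- The matrix-valued measure is symmetric and positive semidefinite. -/
def MatrixMeasure.IsPSD (Φ : MatrixMeasure m X) : Prop :=
  (∀ i j, Φ.entry i j = Φ.entry j i) ∧
    ∀ A : Set X, MeasurableSet A → ∀ v : Fin m → ℝ, 0 ≤ v ⬝ᵥ (Matrix.mulVec (Φ A) v)

/-- `h` is integrable with respect to each entry of `Φ`. -/
def MatrixMeasure.IsIntegrable (Φ : MatrixMeasure m X) (h : X → ℝ) : Prop :=
  ∀ i j, (Φ.entry i j).Integrable h

/-- The matrix `∫ h dΦ = [∫ h dφ_ij]`. -/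
def MatrixMeasure.matrixIntegral (Φ : MatrixMeasure m X) (h : X → ℝ) : Matrix (Fin m) (Fin m) ℝ :=
  Matrix.of fun i j => (Φ.entry i j).integral h (ContinuousLinearMap.lsmul ℝ ℝ)

/-- `Φ` is a positive semidefinite matrix-valued measure on `X` with
`S_α = ∫ x^α dΦ(x)` for all `|α| ≤ d`. -/
def IsRepresentingMeasure {d : ℕ} (S : TruncSeq n m d) (Φ : MatrixMeasure m X) : Prop :=
  Φ.IsPSD ∧ ∀ α : MultiIndex n d,
    Φ.IsIntegrable (fun x => monomialFun α.1 x.1) ∧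
      S α = Φ.matrixIntegral (fun x => monomialFun α.1 x.1)

/-- The finitely atomic matrix-valued measure `∑ᵢ Wᵢ δ_{xᵢ}`. -/
def atomicMeasure {r : ℕ} (W : Fin r → Matrix (Fin m) (Fin m) ℝ) (x : Fin r → X) :
    MatrixMeasure m X :=
  ∑ i, VectorMeasure.dirac (x i) (W i)

end MatrixMoment

end

/-!
Write `d = k + d_G`; then `d > k` because `G` is not constant.

From an atomic measure to an extension: the moments `S'_α = ∑ₜ x_t^α W_t` up to degree `2 d` of the
same measure give `M_d(S') = ∑ₜ v_t v_tᵀ ⊗ W_t` and `M_k(G S') = ∑ₜ v_t v_tᵀ ⊗ W_t ⊗ G(x_t)`, where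
`v_t` is the vector of monomials at `x_t`; both are positive semidefinite.  The rank of `M_d(S')`
lies between that of its submatrix `M_k(S)` and `∑ₜ rank W_t`, which agree by assumption.

From a flat extension to an atomic measure: `M_d(S')` is the Gram matrix of vectors `u α i`
(`Matrix.PosSemidef.exists_gram`), and equality of ranks means that those with `|α| ≤ k` span the
same space `E` as all of them, of dimension `rank M_k(S)`.  As `⟪u α i, u β j⟫` depends on `α + β`
only and `d > k`, the shifts `u α i ↦ u (α + eₗ) i` define commuting symmetric operators on `E`.
An orthonormal basis `b t` of joint eigenvectors with joint eigenvalues `x t` satisfies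
`⟪b t, u α i⟫ = (x t)^α ⟪b t, u 0 i⟫` (`exists_orthonormalBasis_of_flat_hankel`), and Parseval's
identity reads `S'_α = ∑ₜ (x t)^α c_t c_tᵀ` with `c_t i = ⟪b t, u 0 i⟫`
(`MatrixMoment.exists_atoms_of_flat_extension`).  Since the `u α i` with `|α| ≤ k` span `E`, some
combination of them equals `b t`; testing `M_k(G S') ⪰ 0` on its coefficients tensored with `w`
isolates `wᵀ G(x_t) w ≥ 0` (`MatrixMoment.mem_psdSet_of_posSemidef_localizingMatrix`).  Finally,
atoms at equal points are merged (`MatrixMoment.exists_injective_atoms`); the total rank of the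
weights is then at most `dim E = rank M_k(S)`, and at least this by subadditivity of the rank.
-/

/-! ### Exponents -/

namespace Finsupp

theorem exists_eq_add_single_of_degree_eq_succ {σ : Type*} {α : σ →₀ ℕ} {N : ℕ}
    (h : α.degree = N + 1) : ∃ β l, α = β + single l 1 ∧ β.degree = N := by
  classical
  obtain ⟨l, hl⟩ : ∃ l, α l ≠ 0 := by
    by_contra! h0
    obtain rfl : α = 0 := by ext l; simp [h0]
    simp at h
  have hle : single l 1 ≤ α := by simpa using Nat.one_le_iff_ne_zero.mpr hl
  have hα : α = (α - single l 1) + single l 1 := (tsub_add_cancel_of_le hle).symm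
  refine ⟨_, l, hα, ?_⟩
  rw [hα, map_add, degree_single] at h
  omega

theorem exists_add_of_degree_le_add {σ : Type*} {α : σ →₀ ℕ} {a b : ℕ} (h : α.degree ≤ a + b) :
    ∃ β γ, α = β + γ ∧ β.degree ≤ a ∧ γ.degree ≤ b := by
  induction b generalizing α with
  | zero => exact ⟨α, 0, by simpa using h⟩
  | succ b ih =>
    rcases h.lt_or_eq with h | h
    · obtain ⟨β, γ, hα, hβ, hγ⟩ := ih (Nat.le_of_lt_succ h)
      exact ⟨β, γ, hα, hβ, hγ.trans b.le_succ⟩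
    · obtain ⟨α, l, rfl, hα⟩ := exists_eq_add_single_of_degree_eq_succ h
      obtain ⟨β, γ, rfl, hβ, hγ⟩ := ih hα.le
      exact ⟨β, γ + single l 1, add_assoc _ _ _, hβ, by rw [map_add, degree_single]; omega⟩

end Finsupp

/-! ### Ranks -/

namespace Matrix

theorem rank_sum_le {ι μ ν : Type*} [Fintype ν] [Finite μ] (s : Finset ι)
    (A : ι → Matrix μ ν ℝ) : (∑ i ∈ s, A i).rank ≤ ∑ i ∈ s, (A i).rank := by
  classical
  have key (B C : Matrix μ ν ℝ) : (B + C).rank ≤ B.rank + C.rank := by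
    unfold Matrix.rank
    rw [Matrix.mulVecLin_add]
    exact (Submodule.finrank_mono (LinearMap.range_add_le _ _)).trans
      (Submodule.finrank_add_le_finrank_add_finrank _ _)
  induction s using Finset.induction_on with
  | empty => simp
  | insert i s hi ih =>
    rw [Finset.sum_insert hi, Finset.sum_insert hi]
    exact (key _ _).trans (by gcongr)

/-- `v vᵀ ⊗ W` factors through `W`, as `A W Aᵀ` with `A = v ⊗ 1`. -/
theorem rank_vecMulVec_kronecker_le {ι μ : Type*} [Fintype ι] [Fintype μ]
    (v : ι → ℝ) (W : Matrix μ μ ℝ) : (vecMulVec v v ⊗ₖ W).rank ≤ W.rank := by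
  classical
  set A : Matrix (ι × μ) μ ℝ := of fun p j => if p.2 = j then v p.1 else 0 with hA
  have h : vecMulVec v v ⊗ₖ W = A * W * Aᵀ := by
    ext ⟨a, i⟩ ⟨b, j⟩
    simp [hA, Matrix.mul_apply, vecMulVec_apply]
    ring
  rw [h]
  exact (rank_mul_le_left _ _).trans (rank_mul_le_right _ _)

theorem rank_gram {E ι : Type*} [NormedAddCommGroup E] [InnerProductSpace ℝ E]
    [FiniteDimensional ℝ E] [Fintype ι] (v : ι → E) :
    (gram ℝ v).rank = Module.finrank ℝ (Submodule.span ℝ (Set.range v)) := by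
  let b := stdOrthonormalBasis ℝ E
  rw [gram_eq_conjTranspose_mul b v, rank_conjTranspose_mul_self, rank_eq_finrank_span_cols]
  have hr : Set.range (of fun i j => b.repr (v j) i : Matrix _ ι ℝ).col =
      (b.toBasis.equivFun : E →ₗ[ℝ] _) '' Set.range v := by
    rw [← Set.range_comp]
    congr 1
  rw [hr, ← Submodule.map_span]
  exact LinearEquiv.finrank_map_eq b.toBasis.equivFun _

theorem PosSemidef.exists_gram {ι : Type*} [Fintype ι] {M : Matrix ι ι ℝ} (hM : M.PosSemidef) :
    ∃ v : ι → EuclideanSpace ℝ ι, gram ℝ v = M := by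
  classical
  open scoped MatrixOrder in
  obtain ⟨B, rfl⟩ := CStarAlgebra.nonneg_iff_eq_star_mul_self.mp hM.nonneg
  refine ⟨fun j => WithLp.toLp 2 (B.col j), ?_⟩
  ext i j
  simp [gram_apply, Matrix.mul_apply, PiLp.inner_apply, star_eq_conjTranspose, mul_comm]

end Matrix

/-! ### Commuting symmetric operators -/

section Operators

open Module

variable {E : Type*} [NormedAddCommGroup E] [InnerProductSpace ℝ E]

/-- Vectors with the same inner products against a spanning family are equal. -/
theorem eq_of_forall_inner_eq_of_span_eq_top {ι : Type*} {v : ι → E}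
    (hv : Submodule.span ℝ (Set.range v) = ⊤) {y z : E}
    (h : ∀ a, inner ℝ y (v a) = inner ℝ z (v a)) : y = z := by
  have h2 : innerₗ E y = innerₗ E z := LinearMap.ext_on_range hv (by simpa using h)
  exact ext_inner_right ℝ fun w => by simpa using congr($h2 w)

/-- On a spanning family `v`, the assignment `v a ↦ w a` extends to a symmetric operator as soon as
it is formally symmetric; formal symmetry already forces it to be well defined, for a linear
relation among the `v a` makes the same combination of the `w a` orthogonal to all `v b`. -/
theorem exists_isSymmetric_of_inner_eq {ι : Type*} {v w : ι → E}
    (hv : Submodule.span ℝ (Set.range v) = ⊤)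
    (h : ∀ a b, inner ℝ (w a) (v b) = inner ℝ (v a) (w b)) :
    ∃ T : E →ₗ[ℝ] E, T.IsSymmetric ∧ ∀ a, T (v a) = w a := by
  classical
  have hadj (c : ι →₀ ℝ) (b : ι) : inner ℝ (Finsupp.linearCombination ℝ w c) (v b) =
      inner ℝ (Finsupp.linearCombination ℝ v c) (w b) := by
    simp [Finsupp.linearCombination_apply, Finsupp.sum_inner, inner_smul_left, h]
  obtain ⟨g, hg⟩ := (Finsupp.linearCombination ℝ v).exists_rightInverse_of_surjective
    (by rw [Finsupp.range_linearCombination, hv])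
  have hg' (y : E) : Finsupp.linearCombination ℝ v (g y) = y := congr($hg y)
  have hT (y : E) (b : ι) :
      inner ℝ ((Finsupp.linearCombination ℝ w ∘ₗ g) y) (v b) = inner ℝ y (w b) := by
    rw [LinearMap.comp_apply, hadj, hg']
  have hTv (a : ι) : (Finsupp.linearCombination ℝ w ∘ₗ g) (v a) = w a :=
    eq_of_forall_inner_eq_of_span_eq_top hv fun b => by rw [hT, h]
  refine ⟨Finsupp.linearCombination ℝ w ∘ₗ g, fun y z => ?_, hTv⟩
  generalize Finsupp.linearCombination ℝ w ∘ₗ g = T at hT hTv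
  have h2 : innerₗ E (T y) = innerₗ E y ∘ₗ T :=
    LinearMap.ext_on_range hv fun b => by simp [hT, hTv]
  simpa using congr($h2 z)

/-- Simultaneous diagonalization of a commuting family of symmetric operators, as an orthonormal
basis of joint eigenvectors. -/
theorem exists_orthonormalBasis_joint_eigenvectors [FiniteDimensional ℝ E] {σ : Type*}
    {T : σ → E →ₗ[ℝ] E} (hT : ∀ l, (T l).IsSymmetric) (hc : ∀ l p, Commute (T l) (T p)) :
    ∃ (b : OrthonormalBasis (Fin (finrank ℝ E)) ℝ E) (x : Fin (finrank ℝ E) → σ → ℝ),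
      ∀ t l, T l (b t) = x t l • b t := by
  classical
  have hV := LinearMap.IsSymmetric.directSum_isInternal_of_pairwise_commute hT
    (fun l p _ => hc l p)
  have hO := LinearMap.IsSymmetric.orthogonalFamily_iInf_eigenspaces hT
  -- `subordinateOrthonormalBasis` is indexed over finitely many summands: drop the zero ones.
  have hfin : {χ : σ → ℝ | (⨅ l, End.eigenspace (T l) (χ l)) ≠ ⊥}.Finite :=
    WellFoundedGT.finite_ne_bot_of_iSupIndep hV.submodule_iSupIndep
  have : Fintype {χ : σ → ℝ // (⨅ l, End.eigenspace (T l) (χ l)) ≠ ⊥} := hfin.fintype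
  have hV' := DirectSum.isInternal_ne_bot_iff.mpr hV
  have hO' := hO.comp (γ := {χ : σ → ℝ // (⨅ l, End.eigenspace (T l) (χ l)) ≠ ⊥})
    Subtype.val_injective
  refine ⟨hV'.subordinateOrthonormalBasis rfl hO',
    fun t => (hV'.subordinateOrthonormalBasisIndex rfl t hO').1, fun t l => ?_⟩
  have h := hV'.subordinateOrthonormalBasis_subordinate rfl t hO'
  exact End.mem_eigenspace_iff.mp ((Submodule.mem_iInf _).mp h l)

/-- The flat extension argument.  If the vectors `u α i` have inner products that depend on
`α + β` only, and those with `|α| ≤ k` span the space while the Hankel property persists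
up to a degree `d > k`, then the shifts `u α i ↦ u (α + eₗ) i` are commuting symmetric operators;
their joint eigenvalues `x t` satisfy `⟪b t, u α i⟫ = (x t)^α ⟪b t, u 0 i⟫`. -/
theorem exists_orthonormalBasis_of_flat_hankel [FiniteDimensional ℝ E] {n : ℕ} {ι : Type*}
    {k d : ℕ} (hkd : k < d) (u : (Fin n →₀ ℕ) → ι → E)
    (hspan : Submodule.span ℝ (Set.range fun a : {α : Fin n →₀ ℕ // α.degree ≤ k} × ι =>
      u a.1.1 a.2) = ⊤)
    (hank : ∀ α β α' β' : Fin n →₀ ℕ, α.degree ≤ d → β.degree ≤ d → α'.degree ≤ d →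
      β'.degree ≤ d → α + β = α' + β' → ∀ i j, inner ℝ (u α i) (u β j) = inner ℝ (u α' i) (u β' j)) :
    ∃ (b : OrthonormalBasis (Fin (finrank ℝ E)) ℝ E) (x : Fin (finrank ℝ E) → Fin n → ℝ),
      ∀ (α : Fin n →₀ ℕ), α.degree ≤ d → ∀ i t,
        inner ℝ (b t) (u α i) = (∏ l, x t l ^ α l) * inner ℝ (b t) (u 0 i) := by
  classical
  have hdeg (α : Fin n →₀ ℕ) (l : Fin n) : (α + Finsupp.single l 1).degree = α.degree + 1 := by
    simp
  have hT (l : Fin n) : ∃ T : E →ₗ[ℝ] E, T.IsSymmetric ∧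
      ∀ a : {α : Fin n →₀ ℕ // α.degree ≤ k} × ι,
        T (u a.1.1 a.2) = u (a.1.1 + Finsupp.single l 1) a.2 := by
    refine exists_isSymmetric_of_inner_eq hspan fun a b => ?_
    have := a.1.2
    have := b.1.2
    exact hank _ _ _ _ (by rw [hdeg]; omega) (by omega) (by omega) (by rw [hdeg]; omega)
      (by abel) _ _
  choose T hTs hTu using hT
  -- The symmetry of `T l` extends the shift relation from degrees `≤ k` to degrees `< d`.
  have hshift (l : Fin n) (α : Fin n →₀ ℕ) (hα : α.degree < d) (i : ι) :
      T l (u α i) = u (α + Finsupp.single l 1) i := by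
    refine eq_of_forall_inner_eq_of_span_eq_top hspan fun b => ?_
    have := b.1.2
    rw [hTs, hTu]
    exact hank _ _ _ _ hα.le (by rw [hdeg]; omega) (by rw [hdeg]; omega) (by omega)
      (by abel) _ _
  -- Against `u β j`, both products give `u (α + eₚ) i` paired with `u (β + eₗ) j`, up to swapping
  -- `l` and `p`.
  have hcomm (l p : Fin n) : Commute (T l) (T p) := by
    refine LinearMap.ext_on_range hspan fun a => ?_
    refine eq_of_forall_inner_eq_of_span_eq_top hspan fun b => ?_
    have := a.1.2
    have := b.1.2
    rw [Module.End.mul_apply, Module.End.mul_apply, hTs l (T p _), hTs p (T l _), hTu l b,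
      hTu p b, hTu l a, hTu p a]
    exact hank _ _ _ _ (by rw [hdeg]; omega) (by rw [hdeg]; omega) (by rw [hdeg]; omega)
      (by rw [hdeg]; omega) (by abel) _ _
  obtain ⟨b, x, hbx⟩ := exists_orthonormalBasis_joint_eigenvectors hTs hcomm
  refine ⟨b, x, fun α => ?_⟩
  induction hN : α.degree generalizing α with
  | zero =>
    obtain rfl : α = 0 := (Finsupp.degree_eq_zero_iff α).mp hN
    simp
  | succ N ih =>
    intro hα i t
    obtain ⟨β, l, rfl, hβ⟩ := Finsupp.exists_eq_add_single_of_degree_eq_succ hN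
    rw [← hshift l β (by omega), ← hTs, hbx, inner_smul_left, ih β hβ (by omega)]
    simp only [Finsupp.add_apply, pow_add, Finset.prod_mul_distrib, Finsupp.single_apply, pow_ite,
      pow_one, pow_zero, Finset.prod_ite_eq, Finset.mem_univ, if_true, conj_trivial]
    ring

end Operators

/-! ### Atomic matrix-valued measures -/

namespace MatrixMoment

theorem continuous_monomialFun {n : ℕ} (α : Fin n →₀ ℕ) :
    Continuous (monomialFun α) := by
  unfold monomialFun
  fun_prop

theorem monomialFun_add {n : ℕ} (α β : Fin n →₀ ℕ) (x : Fin n → ℝ) :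
    monomialFun (α + β) x = monomialFun α x * monomialFun β x := by
  simp [monomialFun, pow_add, Finset.prod_mul_distrib]

theorem entry_atomicMeasure {n m r : ℕ} {X : Set (Fin n → ℝ)}
    (W : Fin r → Matrix (Fin m) (Fin m) ℝ) (x : Fin r → X) (i j : Fin m) :
    (atomicMeasure W x).entry i j = ∑ t, VectorMeasure.dirac (x t) (W t i j) := by
  classical
  ext A hA
  have h : (atomicMeasure W x).entry i j A = atomicMeasure W x A i j := rfl
  rw [h, atomicMeasure, FunLike.coe_sum, FunLike.coe_sum, Finset.sum_apply, Finset.sum_apply,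
    Matrix.sum_apply]
  refine Finset.sum_congr rfl fun t _ => ?_
  by_cases h : x t ∈ A <;> simp [h, hA]

theorem isPSD_atomicMeasure {n m r : ℕ} {X : Set (Fin n → ℝ)}
    {W : Fin r → Matrix (Fin m) (Fin m) ℝ} (hW : ∀ t, (W t).PosSemidef) (x : Fin r → X) :
    (atomicMeasure W x).IsPSD := by
  refine ⟨fun i j => ?_, fun A hA v => ?_⟩
  · simp only [entry_atomicMeasure]
    refine Finset.sum_congr rfl fun t _ => ?_
    rw [← (hW t).isHermitian.apply i j, star_trivial]
  · rw [atomicMeasure, FunLike.coe_sum, Finset.sum_apply, Matrix.sum_mulVec,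
      dotProduct_sum]
    refine Finset.sum_nonneg fun t _ => ?_
    by_cases h : x t ∈ A
    · rw [VectorMeasure.dirac_apply_of_mem hA h]
      simpa using (hW t).dotProduct_mulVec_nonneg v
    · simp [h]

theorem isRepresentingMeasure_atomicMeasure_iff {n m r d : ℕ} {X : Set (Fin n → ℝ)}
    {W : Fin r → Matrix (Fin m) (Fin m) ℝ} (hW : ∀ t, (W t).PosSemidef) (x : Fin r → X)
    (S : TruncSeq n m d) :
    IsRepresentingMeasure S (atomicMeasure W x) ↔
      ∀ α, S α = ∑ t, monomialFun α.1 (x t).1 • W t := by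
  have hint (α : Fin n →₀ ℕ) (a : X) (c : ℝ) :
      (VectorMeasure.dirac a c).Integrable fun y : X => monomialFun α y.1 := by
    rw [VectorMeasure.Integrable, VectorMeasure.variation_dirac]
    exact (integrable_dirac (by simp)).smul_measure (by simp)
  have hval (α : Fin n →₀ ℕ) :
      (atomicMeasure W x).matrixIntegral (fun y => monomialFun α y.1) =
        ∑ t, monomialFun α (x t).1 • W t := by
    ext i j
    simp only [MatrixMeasure.matrixIntegral, Matrix.of_apply, entry_atomicMeasure]
    rw [VectorMeasure.integral_finsetSum_vectorMeasure fun t _ => hint α (x t) _]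
    simp [Matrix.sum_apply, VectorMeasure.integral_dirac]
  refine ⟨fun h α => (h.2 α).2.trans (hval α.1), fun h => ⟨isPSD_atomicMeasure hW x, fun α =>
    ⟨fun i j => ?_, (h α).trans (hval α.1).symm⟩⟩⟩
  rw [entry_atomicMeasure]
  exact VectorMeasure.Integrable.finsetSum_vectorMeasure fun t _ => hint α.1 (x t) _

/-! ### Moment and localizing matrices of atomic sequences -/

theorem PolyMatrix.evalAt_apply_eq_sum {n q : ℕ} (G : PolyMatrix n q) (x : Fin n → ℝ)
    (a b : Fin q) :
    G.evalAt x a b = ∑ γ ∈ G.supp, monomialFun γ x * G.coeffMatrix γ a b := by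
  simp only [PolyMatrix.evalAt, PolyMatrix.coeffMatrix, Matrix.map_apply, MvPolynomial.eval_eq']
  refine Finset.sum_subset_zero_on_sdiff ?_ ?_ ?_
  · exact Finset.subset_biUnion_of_mem (fun p : Fin q × Fin q => (G p.1 p.2).support)
      (Finset.mem_univ (a, b))
  · intro γ hγ
    simp [MvPolynomial.notMem_support_iff.mp (Finset.mem_sdiff.mp hγ).2]
  · intro γ _
    rw [mul_comm, monomialFun]

/-- The vector `(x^α)_{|α| ≤ k}`. -/
def monomialVec {n : ℕ} (k : ℕ) (x : Fin n → ℝ) : MultiIndex n k → ℝ :=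
  fun α => monomialFun α.1 x

theorem momentMatrix_eq_sum {n m k : ℕ} {τ : Type*} [Fintype τ] {S : TruncSeq n m (2 * k)}
    {x : τ → Fin n → ℝ} {W : τ → Matrix (Fin m) (Fin m) ℝ}
    (hS : ∀ α, S α = ∑ t, monomialFun α.1 (x t) • W t) :
    momentMatrix S =
      ∑ t, Matrix.vecMulVec (monomialVec k (x t)) (monomialVec k (x t)) ⊗ₖ W t := by
  ext ⟨α, i⟩ ⟨β, j⟩
  simp [momentMatrix, hS, Matrix.sum_apply, Matrix.vecMulVec_apply, monomialVec, monomialFun_add]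

theorem localizingMatrix_eq_sum {n m q k : ℕ} (G : PolyMatrix n q) {τ : Type*} [Fintype τ]
    {S : TruncSeq n m (2 * (k + G.halfDeg))}
    {x : τ → Fin n → ℝ} {W : τ → Matrix (Fin m) (Fin m) ℝ}
    (hS : ∀ α, S α = ∑ t, monomialFun α.1 (x t) • W t) :
    localizingMatrix G S =
      ∑ t, Matrix.vecMulVec (monomialVec k (x t)) (monomialVec k (x t)) ⊗ₖ
        (W t ⊗ₖ G.evalAt (x t)) := by
  ext ⟨α, i, a⟩ ⟨β, j, b⟩
  simp only [localizingMatrix, hS, Matrix.of_apply, Matrix.sum_apply, Matrix.kroneckerMap_apply,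
    Matrix.vecMulVec_apply, monomialVec, monomialFun_add, Matrix.smul_apply, smul_eq_mul,
    PolyMatrix.evalAt_apply_eq_sum, Finset.sum_mul, Finset.mul_sum]
  rw [Finset.sum_comm]
  refine Finset.sum_congr rfl fun t _ => ?_
  rw [← Finset.sum_attach G.supp]
  refine Finset.sum_congr rfl fun γ _ => ?_
  ring

theorem posSemidef_vecMulVec_self {ι : Type*} [Finite ι] (v : ι → ℝ) :
    (Matrix.vecMulVec v v).PosSemidef := by
  simpa using Matrix.posSemidef_vecMulVec_self_star v

theorem posSemidef_momentMatrix {n m k : ℕ} {τ : Type*} [Fintype τ] {S : TruncSeq n m (2 * k)}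
    {x : τ → Fin n → ℝ} {W : τ → Matrix (Fin m) (Fin m) ℝ} (hW : ∀ t, (W t).PosSemidef)
    (hS : ∀ α, S α = ∑ t, monomialFun α.1 (x t) • W t) : (momentMatrix S).PosSemidef := by
  rw [momentMatrix_eq_sum hS]
  exact Matrix.posSemidef_sum _ fun t _ => (posSemidef_vecMulVec_self _).kronecker (hW t)

theorem posSemidef_localizingMatrix {n m q k : ℕ} {G : PolyMatrix n q} {τ : Type*} [Fintype τ]
    {S : TruncSeq n m (2 * (k + G.halfDeg))}
    {x : τ → Fin n → ℝ} {W : τ → Matrix (Fin m) (Fin m) ℝ} (hW : ∀ t, (W t).PosSemidef)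
    (hx : ∀ t, x t ∈ G.psdSet)
    (hS : ∀ α, S α = ∑ t, monomialFun α.1 (x t) • W t) : (localizingMatrix G S).PosSemidef := by
  rw [localizingMatrix_eq_sum G hS]
  exact Matrix.posSemidef_sum _ fun t _ =>
    (posSemidef_vecMulVec_self _).kronecker ((hW t).kronecker (hx t))

theorem rank_momentMatrix_le {n m k : ℕ} {τ : Type*} [Fintype τ] {S : TruncSeq n m (2 * k)}
    {x : τ → Fin n → ℝ} {W : τ → Matrix (Fin m) (Fin m) ℝ}
    (hS : ∀ α, S α = ∑ t, monomialFun α.1 (x t) • W t) :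
    (momentMatrix S).rank ≤ ∑ t, (W t).rank := by
  rw [momentMatrix_eq_sum hS]
  exact (Matrix.rank_sum_le _ _).trans
    (Finset.sum_le_sum fun t _ => Matrix.rank_vecMulVec_kronecker_le _ _)

theorem momentMatrix_eq_submatrix {n m k d : ℕ} {S : TruncSeq n m (2 * k)}
    {S' : TruncSeq n m (2 * d)} (hkd : k ≤ d) (h : S.IsExtension S') :
    momentMatrix S = (momentMatrix S').submatrix
      (fun a => (⟨a.1.1, a.1.2.trans hkd⟩, a.2)) (fun a => (⟨a.1.1, a.1.2.trans hkd⟩, a.2)) := by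
  ext ⟨α, i⟩ ⟨β, j⟩
  exact congr($(h.2 _ _ rfl) i j).symm

/-! ### Merging coinciding atoms -/

/-- Atoms at the same point are merged by adding their weights, which does not increase the total
rank. -/
theorem exists_injective_atoms {τ P μ : Type*} [Fintype τ] [Fintype μ] (x : τ → P)
    {W : τ → Matrix μ μ ℝ} (hW : ∀ t, (W t).PosSemidef) :
    ∃ (r : ℕ) (V : Fin r → Matrix μ μ ℝ) (y : Fin r → P), (∀ i, (V i).PosSemidef) ∧
      Function.Injective y ∧ (∀ f : P → ℝ, ∑ t, f (x t) • W t = ∑ i, f (y i) • V i) ∧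
      ∑ i, (V i).rank ≤ ∑ t, (W t).rank := by
  classical
  let e := (Finset.univ.image x).equivFin
  have hx (t : τ) : x t ∈ Finset.univ.image x := Finset.mem_image_of_mem x (Finset.mem_univ t)
  refine ⟨_, fun i => ∑ t with x t = (e.symm i).1, W t, fun i => (e.symm i).1,
    fun i => Matrix.posSemidef_sum _ fun t _ => hW t,
    Subtype.val_injective.comp e.symm.injective, fun f => ?_, ?_⟩
  · rw [e.symm.sum_comp fun p => f p.1 • ∑ t with x t = p.1, W t,
      Finset.sum_coe_sort (Finset.univ.image x) fun p => f p • ∑ t with x t = p, W t,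
      ← Finset.sum_fiberwise_of_maps_to (fun t _ => hx t)]
    refine Finset.sum_congr rfl fun p _ => ?_
    rw [Finset.smul_sum]
    exact Finset.sum_congr rfl fun t ht => by rw [(Finset.mem_filter.mp ht).2]
  · refine (Finset.sum_le_sum fun i _ => Matrix.rank_sum_le _ _).trans_eq ?_
    rw [e.symm.sum_comp fun p => ∑ t with x t = p.1, (W t).rank,
      Finset.sum_coe_sort (Finset.univ.image x) fun p => ∑ t with x t = p, (W t).rank,
      ← Finset.sum_fiberwise_of_maps_to (fun t _ => hx t)]

end MatrixMoment

/-! ### Flat extensions -/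

namespace MatrixMoment

open Module

/-- A flat extension is atomic, with rank-one weights, one for each vector of an orthonormal basis
of joint eigenvectors; the points are not claimed to be distinct.  The coefficient
functions `p t` interpolate: `p t` pairs to `1` with the `t`-th atom and to `0` with the others. -/
theorem exists_atoms_of_flat_extension {n m k d : ℕ} (hkd : k < d)
    {S : TruncSeq n m (2 * k)} {S' : TruncSeq n m (2 * d)} (hext : S.IsExtension S')
    (hpsd : (momentMatrix S').PosSemidef)
    (hrank : (momentMatrix S).rank = (momentMatrix S').rank) :
    ∃ (x : Fin (momentMatrix S).rank → Fin n → ℝ) (c : Fin (momentMatrix S).rank → Fin m → ℝ)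
      (p : Fin (momentMatrix S).rank → MultiIndex n k × Fin m → ℝ),
      (∀ α, S' α = ∑ t, monomialFun α.1 (x t) • Matrix.vecMulVec (c t) (c t)) ∧
      ∀ t s, ∑ a, p t a * (monomialFun a.1.1 (x s) * c s a.2) = if t = s then 1 else 0 := by
  classical
  obtain ⟨v, hv⟩ := hpsd.exists_gram
  let E := Submodule.span ℝ (Set.range v)
  have hvE (a) : v a ∈ E := Submodule.subset_span ⟨a, rfl⟩
  let u : (Fin n →₀ ℕ) → Fin m → E := fun α i =>
    if h : α.degree ≤ d then ⟨v (⟨α, h⟩, i), hvE _⟩ else 0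
  have hu {α : Fin n →₀ ℕ} (h : α.degree ≤ d) (i : Fin m) :
      u α i = ⟨v (⟨α, h⟩, i), hvE _⟩ := dif_pos h
  have hinner {α β : Fin n →₀ ℕ} (hα : α.degree ≤ d) (hβ : β.degree ≤ d) (i j : Fin m) :
      inner ℝ (u α i) (u β j) = S' ⟨α + β, degree_add_le ⟨α, hα⟩ ⟨β, hβ⟩⟩ i j := by
    rw [hu hα, hu hβ, Submodule.coe_inner]
    exact congr($hv (⟨α, hα⟩, i) (⟨β, hβ⟩, j))
  let w : MultiIndex n k × Fin m → E := fun a => u a.1.1 a.2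
  have hgram : momentMatrix S = Matrix.gram ℝ w := by
    ext ⟨α, i⟩ ⟨β, j⟩
    rw [Matrix.gram_apply, hinner (α.2.trans hkd.le) (β.2.trans hkd.le)]
    exact congr($(hext.2 _ _ rfl) i j).symm
  have hfin : finrank ℝ E = (momentMatrix S).rank := by
    rw [hrank, ← hv, Matrix.rank_gram]
  -- Flatness says that the vectors of degree at most `k` already span.
  have hspan : Submodule.span ℝ (Set.range w) = ⊤ :=
    Submodule.eq_top_of_finrank_eq (by rw [hfin, hgram, Matrix.rank_gram])
  rw [← hfin]
  obtain ⟨b, x, hbx⟩ := exists_orthonormalBasis_of_flat_hankel hkd u hspan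
    fun α β α' β' hα hβ hα' hβ' h i j => by
      rw [hinner hα hβ, hinner hα' hβ']
      simp only [h]
  have hp (t) : ∃ p : MultiIndex n k × Fin m → ℝ, ∑ a, p a • w a = b t :=
    (Submodule.mem_span_range_iff_exists_fun ℝ).mp (hspan ▸ Submodule.mem_top)
  choose p hp using hp
  refine ⟨x, fun t i => inner ℝ (b t) (u 0 i), p, fun α => ?_, fun t s => ?_⟩
  · obtain ⟨β, γ, hα, hβ, hγ⟩ :=
      Finsupp.exists_add_of_degree_le_add (α := α.1) (a := d) (b := d) (by have := α.2; omega)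
    ext i j
    have hS : S' α i j = inner ℝ (u β i) (u γ j) := by
      rw [hinner hβ hγ]
      congr 2
      exact Subtype.ext hα
    rw [hS, ← b.sum_inner_mul_inner, Matrix.sum_apply]
    refine Finset.sum_congr rfl fun t _ => ?_
    rw [real_inner_comm, hbx β hβ, hbx γ hγ, hα, monomialFun_add]
    simp only [monomialFun, Matrix.smul_apply, Matrix.vecMulVec_apply, smul_eq_mul]
    ring
  · have h : inner ℝ (b s) (b t) = if s = t then (1 : ℝ) else 0 :=
      orthonormal_iff_ite.mp b.orthonormal s t
    rw [← hp t, inner_sum] at h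
    simp only [eq_comm (a := t), ← h]
    refine Finset.sum_congr rfl fun a _ => ?_
    refine Eq.trans ?_ (real_inner_smul_right (b s) (w a) (p t a)).symm
    rw [hbx _ (a.1.2.trans hkd.le)]
    rfl

/-- Testing the localizing matrix on `p t ⊗ w`, where `p t` singles out the `t`-th atom, leaves
only the term `wᵀ G(x t) w`. -/
theorem mem_psdSet_of_posSemidef_localizingMatrix {n m q k : ℕ} {G : PolyMatrix n q}
    (hG : G.IsSymm) {τ : Type*} [Fintype τ] [DecidableEq τ]
    {S : TruncSeq n m (2 * (k + G.halfDeg))} {x : τ → Fin n → ℝ} {c : τ → Fin m → ℝ}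
    (hS : ∀ α, S α = ∑ t, monomialFun α.1 (x t) • Matrix.vecMulVec (c t) (c t))
    (hloc : (localizingMatrix G S).PosSemidef) (t : τ) {p : MultiIndex n k × Fin m → ℝ}
    (hp : ∀ s, ∑ a, p a * (monomialFun a.1.1 (x s) * c s a.2) = if t = s then 1 else 0) :
    x t ∈ G.psdSet := by
  refine Matrix.PosSemidef.of_dotProduct_mulVec_nonneg ?_ fun w => ?_
  · ext a b
    simp [PolyMatrix.evalAt, hG.apply a b]
  have h := hloc.dotProduct_mulVec_nonneg fun z => p (z.1, z.2.1) * w z.2.2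
  convert h using 1
  have hfac (f : MultiIndex n k × Fin m → ℝ) (g : Fin q → ℝ) :
      ∑ z : MultiIndex n k × (Fin m × Fin q), f (z.1, z.2.1) * g z.2.2 =
        (∑ a, f a) * ∑ b, g b := by
    simp only [Fintype.sum_prod_type, Finset.sum_mul, ← Finset.mul_sum]
  have hterm (s : τ) : (fun z : MultiIndex n k × (Fin m × Fin q) => p (z.1, z.2.1) * w z.2.2) ⬝ᵥ
      (Matrix.vecMulVec (monomialVec k (x s)) (monomialVec k (x s)) ⊗ₖ
        (Matrix.vecMulVec (c s) (c s) ⊗ₖ G.evalAt (x s))).mulVec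
        (fun z => p (z.1, z.2.1) * w z.2.2) =
      (∑ a, p a * (monomialFun a.1.1 (x s) * c s a.2)) *
        ((∑ a, p a * (monomialFun a.1.1 (x s) * c s a.2)) *
          (w ⬝ᵥ (G.evalAt (x s)).mulVec w)) := by
    have hmul (z : MultiIndex n k × (Fin m × Fin q)) :
        (Matrix.vecMulVec (monomialVec k (x s)) (monomialVec k (x s)) ⊗ₖ
          (Matrix.vecMulVec (c s) (c s) ⊗ₖ G.evalAt (x s))).mulVec
          (fun z => p (z.1, z.2.1) * w z.2.2) z =
        (monomialFun z.1.1 (x s) * c s z.2.1) *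
          ((∑ a, p a * (monomialFun a.1.1 (x s) * c s a.2)) *
            (G.evalAt (x s)).mulVec w z.2.2) := by
      rw [Matrix.mulVec, dotProduct, Matrix.mulVec, dotProduct, ← hfac, Finset.mul_sum]
      refine Finset.sum_congr rfl fun y _ => ?_
      simp only [Matrix.kroneckerMap_apply, Matrix.vecMulVec_apply, monomialVec]
      ring
    rw [mul_left_comm, dotProduct, dotProduct, ← hfac, Finset.mul_sum]
    refine Finset.sum_congr rfl fun z _ => ?_
    rw [hmul]
    ring
  rw [localizingMatrix_eq_sum G hS, Matrix.sum_mulVec, dotProduct_sum]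
  simp only [star_trivial, hterm, hp]
  simp

end MatrixMoment

/-! ### The equivalence -/

theorem mainTheorem1 (n m q k : ℕ) (G : MatrixMoment.PolyMatrix n q) (hG : G.IsSymm)
    (hdeg : 1 ≤ G.deg) (S : MatrixMoment.TruncSeq n m (2 * k)) (hS : S.IsSymm) :
    (∃ (r : ℕ) (W : Fin r → Matrix (Fin m) (Fin m) ℝ) (x : Fin r → G.psdSet),
      (∀ i, (W i).PosSemidef) ∧
      Function.Injective x ∧
      MatrixMoment.IsRepresentingMeasure S (MatrixMoment.atomicMeasure W x) ∧
      ∑ i, (W i).rank = (MatrixMoment.momentMatrix S).rank) ↔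
    ((MatrixMoment.momentMatrix S).PosSemidef ∧
      ∃ S' : MatrixMoment.TruncSeq n m (2 * (k + G.halfDeg)),
        S'.IsSymm ∧
        S.IsExtension S' ∧
        (MatrixMoment.momentMatrix S').PosSemidef ∧
        (MatrixMoment.localizingMatrix G S').PosSemidef ∧
        (MatrixMoment.momentMatrix S).rank = (MatrixMoment.momentMatrix S').rank) := by
  classical
  constructor
  · rintro ⟨r, W, x, hW, -, hrep, hrank⟩
    rw [MatrixMoment.isRepresentingMeasure_atomicMeasure_iff hW] at hrep
    let S' : MatrixMoment.TruncSeq n m (2 * (k + G.halfDeg)) :=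
      fun α => ∑ t, MatrixMoment.monomialFun α.1 (x t).1 • W t
    have hS' (α) : S' α = ∑ t, MatrixMoment.monomialFun α.1 (x t).1 • W t := rfl
    have hext : S.IsExtension S' :=
      ⟨by omega, fun α β h => by rw [hrep, hS', h]⟩
    refine ⟨MatrixMoment.posSemidef_momentMatrix hW hrep, S', fun α => ?_, hext,
      MatrixMoment.posSemidef_momentMatrix hW hS',
      MatrixMoment.posSemidef_localizingMatrix hW (fun t => (x t).2) hS', le_antisymm ?_ ?_⟩
    · rw [hS', Matrix.IsSymm, Matrix.transpose_sum]
      refine Finset.sum_congr rfl fun t _ => ?_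
      rw [Matrix.transpose_smul, ← Matrix.conjTranspose_eq_transpose_of_trivial,
        (hW t).isHermitian.eq]
    · rw [MatrixMoment.momentMatrix_eq_submatrix (Nat.le_add_right _ _) hext]
      exact Matrix.rank_submatrix_le _ _ _
    · exact (MatrixMoment.rank_momentMatrix_le hS').trans_eq hrank
  · rintro ⟨-, S', -, hext, hpsd, hloc, hrank⟩
    have hd : k < k + G.halfDeg := by
      unfold MatrixMoment.PolyMatrix.halfDeg
      omega
    obtain ⟨x, c, p, hatom, hp⟩ :=
      MatrixMoment.exists_atoms_of_flat_extension hd hext hpsd hrank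
    have hx (t) : x t ∈ G.psdSet :=
      MatrixMoment.mem_psdSet_of_posSemidef_localizingMatrix hG hatom hloc t (hp t)
    obtain ⟨r, W, y, hW, hy, hsum, hle⟩ := MatrixMoment.exists_injective_atoms
      (fun t => (⟨x t, hx t⟩ : G.psdSet))
      (fun t => MatrixMoment.posSemidef_vecMulVec_self (c t))
    have hSy (α) : S α = ∑ i, MatrixMoment.monomialFun α.1 (y i).1 • W i := by
      rw [← hsum fun z => MatrixMoment.monomialFun α.1 z.1,
        ← hext.2 α ⟨α.1, α.2.trans hext.1⟩ rfl, hatom]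
    refine ⟨r, W, y, hW, hy,
      (MatrixMoment.isRepresentingMeasure_atomicMeasure_iff hW y S).mpr hSy,
      le_antisymm (hle.trans ?_) (MatrixMoment.rank_momentMatrix_le hSy)⟩
    refine (Finset.sum_le_card_nsmul _ _ 1 fun t _ => Matrix.rank_vecMulVec_le _ _).trans ?_
    simp
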